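/- Let $\mathbb T=\mathbb R/\mathbb Z$, let $\mathfrak c=2^{\aleph_0}$, and let $2^{<\mathfrak c}=\sup\{2^\mu:\mu<\mathfrak c\}$. Topological groups are Hausdorff, quotient groups are taken by closed subgroups and carry the quotient topology, and the weight $w(X)$ of a space $X$ is the least cardinality of a base of $X$. A topological abelian group $G$ is precompact if for every neighbourhood $U$ of $0$ there is a finite $F\subseteq G$ with $F+U=G$; a space is zero-dimensional if its clopen sets form a base. A family of subsets of a set $I$ is almost disjoint if each member has cardinality $|I|$ and any two distinct members meet in a set of cardinality less than $|I|$. Assume $2^{<\mathfrak c}=\mathfrak c$. Then the following hold. (1) Let $I$ and $K$ be sets with $|I|=\mathfrak c$ and $|K|=2^{\mathfrak c}$. There are an almost disjoint family $(Y_k)_{k\in K}$ of pairwise distinct subsets of $I$ (so of size $2^{\mathfrak c}$), bijections $e_k:I\to Y_k$ $(k\in K)$, and a family $(t_i)_{i\in I}$ in $\mathbb T$ that is linearly independent over $\mathbb Z$, such that the subgroup $G$ of $\mathbb T^{I}\cong\mathbb T^{\mathfrak c}$ generated by the points $(t_{e_k(i)})_{i\in I}$, $k\in K$, and the subgroup $H$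 of $\mathbb T^{K}\cong\mathbb T^{2^{\mathfrak c}}$ generated by the points $(t_{e_k(i)})_{k\in K}$, $i\in I$, have the following properties: (a) $G$ is a free abelian group, is dense in $\mathbb T^{I}$, has cardinality $2^{\mathfrak c}$, and every non-trivial closed subgroup of $G$ has cardinality $2^{\mathfrak c}$; (b) $H$ is a free abelian group, is dense in $\mathbb T^{K}$, is zero-dimensional, has cardinality $\mathfrak c$, and has no non-trivial quotient group of weight less than $2^{\mathfrak c}$. (2) The least cardinal $\mathfrak n$ such that every infinite precompact abelian group has an infinite quotient group of weight at most $\mathfrak n$ exists and equals $2^{\mathfrak c}$. -/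

import Mathlib

open Cardinal Topology
open scoped Pointwise

universe u

/-- The weight of a topological space: the least cardinality of a base. -/
noncomputable def topWeight (X : Type u) [TopologicalSpace X] : Cardinal.{u} :=
  sInf {k : Cardinal.{u} | ∃ B : Set (Set X), TopologicalSpace.IsTopologicalBasis B ∧ #B = k}

/-- A space is zero-dimensional if its clopen subsets form a base. -/
def IsZeroDimensional (X : Type u) [TopologicalSpace X] : Prop :=
  TopologicalSpace.IsTopologicalBasis {s : Set X | IsClopen s}

/-- A topological group is precompact if it is covered by finitely many translates
of each neighbourhood of the identity. -/
def IsPrecompactAddGroup (G : Type u) [AddGroup G] [TopologicalSpace G] : Prop :=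
  ∀ U ∈ 𝓝 (0 : G), ∃ F : Set G, F.Finite ∧ F + U = Set.univ

/-- An almost disjoint family of subsets of `X`: every member has the cardinality of `X`, and
two distinct members meet in a set of smaller cardinality. -/
def IsAlmostDisjointFamily {X : Type u} (Ω : Set (Set X)) : Prop :=
  (∀ S ∈ Ω, #S = #X) ∧ ∀ S ∈ Ω, ∀ T ∈ Ω, S ≠ T → #(S ∩ T : Set X) < #X

/-- The cardinals `n` such that every infinite precompact Hausdorff abelian group has an infinite
(Hausdorff) quotient group of weight at most `n`. -/
def quotientWeightBounds : Set Cardinal.{u} :=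
  {n | ∀ (G : Type u) [AddCommGroup G] [TopologicalSpace G] [IsTopologicalAddGroup G]
      [T2Space G], Infinite G → IsPrecompactAddGroup G →
      ∃ N : AddSubgroup G, IsClosed (N : Set G) ∧ Infinite (G ⧸ N) ∧ topWeight (G ⧸ N) ≤ n}

/-- The least cardinal `n` such that every infinite precompact Hausdorff abelian group has an
infinite quotient group of weight at most `n`. -/
noncomputable def leastQuotientWeight : Cardinal.{u} := sInf quotientWeightBounds.{u}

/-- The subgroup of `T ^ κ` that is generated by the points `x i`. -/
def generatedSubgroup {ι κ : Type u} (x : ι → κ → UnitAddCircle) :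
    AddSubgroup (κ → UnitAddCircle) :=
  AddSubgroup.closure (Set.range x)

/-! View `t (e k i)` as a matrix: its rows generate `G`, its columns generate `H`, and integral
combinations of rows act as characters on `H`.

Size of closed subgroups of `G`. Let `b = ∑ n k • x k` be a non-zero element of a closed subgroup
`B`, where `x k` is row `k`. The continuous map `φ v = (∑ n k • v (e k i))_i` sends the multiples of
`t` to the multiples of `b`. By Kronecker's theorem the former are dense in the torus, so the whole
image of `φ` lies in any closed set of the torus that cuts out `B`. Almost disjointness lets one
index of the support of `n` act alone outside a set `J` of fewer than `𝔠` coordinates, so this image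
contains every point vanishing on `J` (`exists_solution`). Hence `B` contains the kernel of the
restriction `G → T ^ J`. As `|T ^ J| ≤ 2 ^< 𝔠 = 𝔠` and `|G| = 2 ^ 𝔠`, this kernel has `2 ^ 𝔠`
elements.

Weight of quotients of `H`. A proper closed subgroup `N` of `H` has a non-trivial annihilator in
`G`. The annihilator is closed, hence has `2 ^ 𝔠` elements, and these are distinct continuous
characters of `H ⧸ N`. A precompact group of weight `w` has at most `w * ℵ₀` continuous characters
(`mk_le_topWeight_of_characters`).

Thus `H` gives the lower bound in (2). For the upper bound, a suitable sequence of neighbourhoods of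
`0` yields an infinite quotient of size at most `𝔠`, whose topology has at most `2 ^ 𝔠` open sets.
-/

/-! ### Density of subgroups of tori -/

open MeasureTheory in
/-- Averaging over a compact group mapped to a finite torus. -/
theorem UnitAddTorus.exists_average {d K : Type*} [Fintype d] [AddCommGroup K] [TopologicalSpace K]
    [IsTopologicalAddGroup K] [CompactSpace K] (φ : K →+ (d → UnitAddCircle))
    (hφ : Continuous φ) (hn : ∀ n : d → ℤ, n ≠ 0 → ∃ k, mFourier n (φ k) ≠ 1) :
    ∃ Λ : C(UnitAddTorus d, ℂ) →L[ℂ] ℂ, (∀ n : d → ℤ, n ≠ 0 → Λ (mFourier n) = 0) ∧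
      Λ (mFourier 0) = 1 ∧ (∀ f : C(UnitAddTorus d, ℂ), (∀ k, f (φ k) = 0) → Λ f = 0) ∧
      (∀ f : UnitAddTorus d → ℝ, ∀ hf : Continuous f, (∀ x, 0 ≤ f x) → ∀ k, f (φ k) ≠ 0 →
        Λ ⟨fun x => (f x : ℂ), by fun_prop⟩ ≠ 0) := by
  borelize K
  let ν : Measure K := Measure.addHaarMeasure ⊤
  have : IsProbabilityMeasure ν := ⟨Measure.addHaarMeasure_self (K₀ := ⊤)⟩
  have hint (f : C(UnitAddTorus d, ℂ)) : Integrable (fun k => f (φ k)) ν :=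
    Continuous.integrable_of_hasCompactSupport (by fun_prop) (HasCompactSupport.of_compactSpace _)
  let Λ₀ : C(UnitAddTorus d, ℂ) →ₗ[ℂ] ℂ :=
    { toFun := fun f => ∫ k, f (φ k) ∂ν
      map_add' := fun f g => by simpa using integral_add (hint f) (hint g)
      map_smul' := fun c f => by simpa using integral_const_mul c (fun k => f (φ k)) }
  let Λ := Λ₀.mkContinuous 1 (fun f => by
    have := norm_integral_le_of_norm_le_const (μ := ν) (f := fun k => f (φ k))
      (Filter.Eventually.of_forall fun k => f.norm_coe_le_norm (φ k))
    simpa [Λ₀] using this)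
  have hΛ (f : C(UnitAddTorus d, ℂ)) : Λ f = ∫ k, f (φ k) ∂ν := rfl
  refine ⟨Λ, fun n hn0 => ?_, ?_, fun f hf => ?_, fun f hf h0 k hk => ?_⟩
  · obtain ⟨k, hk⟩ := hn n hn0
    -- Translation invariance multiplies the integral by `mFourier n (φ k) ≠ 1`, so the integral is
    -- zero.
    have h1 : ∫ x, mFourier n (φ (k + x)) ∂ν = ∫ x, mFourier n (φ x) ∂ν :=
      integral_add_left_eq_self (fun x => mFourier n (φ x)) k
    have h2 (x : K) : mFourier n (φ (k + x)) = mFourier n (φ k) * mFourier n (φ x) := by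
      simp only [map_add, mFourier, ContinuousMap.coe_mk, Pi.add_apply, fourier_apply, smul_add,
        AddCircle.toCircle_add, Circle.coe_mul, Finset.prod_mul_distrib]
    simp_rw [h2] at h1
    rw [integral_const_mul] at h1
    rw [hΛ]
    by_contra hne
    exact hk (mul_right_cancel₀ hne (by rw [h1, one_mul]))
  · simp [hΛ, mFourier_zero]
  · simp [hΛ, hf]
  · rw [hΛ]
    simp only [ContinuousMap.coe_mk]
    rw [integral_complex_ofReal]
    have : 0 < ∫ x, f (φ x) ∂ν :=
      Continuous.integral_pos_of_hasCompactSupport_nonneg_nonzero (by fun_prop)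
        (HasCompactSupport.of_compactSpace _) (fun x => h0 _) hk
    exact_mod_cast this.ne'

theorem UnitAddTorus.mFourier_eq_one_iff {d : Type*} [Fintype d] (n : d → ℤ)
    (x : UnitAddTorus d) : mFourier n x = 1 ↔ ∑ i, n i • x i = 0 := by
  classical
  have h (s : Finset d) : ∏ i ∈ s, fourier (n i) (x i) =
      ((AddCircle.toCircle (∑ i ∈ s, n i • x i) : Circle) : ℂ) := by
    induction s using Finset.induction_on with
    | empty => simp
    | insert a s ha ih =>
      rw [Finset.prod_insert ha, Finset.sum_insert ha, ih, AddCircle.toCircle_add, Circle.coe_mul,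
        fourier_apply]
  have h1 : mFourier n x = ((AddCircle.toCircle (∑ i, n i • x i) : Circle) : ℂ) := h _
  rw [h1, Circle.coe_eq_one, ← AddCircle.toCircle_zero (T := (1 : ℝ))]
  exact (AddCircle.injective_toCircle one_ne_zero).eq_iff

/-- A subgroup of a finite torus that is annihilated by no non-trivial character is dense. -/
theorem UnitAddTorus.dense_of_annihilator_trivial {d : Type*} [Fintype d]
    (M : AddSubgroup (d → UnitAddCircle))
    (hM : ∀ n : d → ℤ, (∀ x ∈ M, ∑ i, n i • x i = 0) → n = 0) :
    Dense (M : Set (d → UnitAddCircle)) := by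
  let C := M.topologicalClosure
  have : CompactSpace C := isCompact_iff_compactSpace.1 M.isClosed_topologicalClosure.isCompact
  have hn (n : d → ℤ) (h0 : n ≠ 0) : ∃ x ∈ M, mFourier n x ≠ 1 := by
    by_contra! h
    exact h0 (hM n fun x hx => (mFourier_eq_one_iff n x).1 (h x hx))
  -- `Λ` averages over the closure of `M`, `Λ'` over the whole torus. They agree on the monomials,
  -- whose span is dense, so they are equal. Yet the distance to the closure has `Λ`-average zero,
  -- and non-zero `Λ'`-average if some `y` lies outside.
  obtain ⟨Λ, h1, h2, h3, -⟩ := exists_average C.subtype continuous_subtype_val (fun n h0 => by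
    obtain ⟨x, hx, h⟩ := hn n h0
    exact ⟨⟨x, M.le_topologicalClosure hx⟩, h⟩)
  obtain ⟨Λ', h1', h2', -, h4⟩ := exists_average (AddMonoidHom.id (d → UnitAddCircle))
    continuous_id (fun n h0 => by
    obtain ⟨x, hx, h⟩ := hn n h0
    exact ⟨x, h⟩)
  have hΛ : Λ = Λ' := by
    refine ContinuousLinearMap.ext_on (s := Set.range (mFourier (d := d))) ?_ ?_
    · rw [dense_iff_closure_eq, ← Submodule.topologicalClosure_coe, span_mFourier_closure_eq_top]
      rfl
    · rintro _ ⟨n, rfl⟩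
      by_cases h : n = 0
      · rw [h, h2, h2']
      · rw [h1 n h, h1' n h]
  intro y
  by_contra hy
  have hcl : (C : Set (d → UnitAddCircle)) = closure M := M.topologicalClosure_coe
  refine h4 (fun x => Metric.infDist x (C : Set (d → UnitAddCircle)))
    (Metric.continuous_infDist_pt _) (fun x => Metric.infDist_nonneg) y ?_ ?_
  · have := (M.isClosed_topologicalClosure.notMem_iff_infDist_pos (x := y) ⟨0, zero_mem C⟩).1
      (by rw [M.topologicalClosure_coe]; exact hy)
    exact this.ne'
  · rw [← hΛ]
    refine h3 _ fun k => ?_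
    simp [Metric.infDist_zero_of_mem k.2]

/-- A subgroup of a torus that is annihilated by no non-trivial character is dense. -/
theorem dense_of_annihilator_trivial {ι : Type*} (M : AddSubgroup (ι → UnitAddCircle))
    (hM : ∀ n : ι →₀ ℤ, (∀ x ∈ M, n.sum (fun i a => a • x i) = 0) → n = 0) :
    Dense (M : Set (ι → UnitAddCircle)) := by
  classical
  refine dense_iff_inter_open.2 fun U hU ⟨y, hy⟩ => ?_
  obtain ⟨F, u, hu, hF⟩ := isOpen_pi_iff.1 hU y hy
  let r : (ι → UnitAddCircle) →+ (F → UnitAddCircle) :=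
    { toFun := fun x i => x i
      map_zero' := rfl
      map_add' := fun _ _ => rfl }
  -- The basic open set involves only the coordinates in `F`, and a character of the finite torus
  -- extends by zero coefficients.
  have hd := UnitAddTorus.dense_of_annihilator_trivial (M.map r) (fun n hn => by
    have key := hM (Finsupp.onFinset F (fun i => if h : i ∈ F then n ⟨i, h⟩ else 0)
      (fun i hi => by by_contra h; simp [h] at hi)) (fun x hx => by
        rw [Finsupp.onFinset_sum _ (fun a => by simp), ← Finset.sum_attach]
        simpa [r] using hn (r x) (AddSubgroup.mem_map_of_mem r hx))
    ext i
    simpa using DFunLike.congr_fun key (i : ι))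
  have hW : IsOpen {x : F → UnitAddCircle | ∀ i : F, x i ∈ u i} := by
    rw [Set.ofPred_forall]
    exact isOpen_iInter_of_finite fun i => (hu i i.2).1.preimage (continuous_apply i)
  obtain ⟨_, hx, x, hxM, rfl⟩ := hd.inter_open_nonempty _ hW ⟨r y, fun i => (hu i i.2).2⟩
  exact ⟨x, hF fun i hi => hx ⟨i, hi⟩, hxM⟩

/-- Kronecker's theorem: a point with independent coordinates generates a dense subgroup. -/
theorem dense_zmultiples_of_linearIndependent {ι : Type*} {t : ι → UnitAddCircle}
    (ht : LinearIndependent ℤ t) : Dense (AddSubgroup.zmultiples t : Set (ι → UnitAddCircle)) :=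
  dense_of_annihilator_trivial _ fun n hn => (linearIndependent_iff.1 ht) n (by
    simpa [Finsupp.linearCombination_apply] using hn t (AddSubgroup.mem_zmultiples t))

/-! ### Almost disjoint sets and independent points of the circle -/

/-- Under `2 ^< 𝔠 = 𝔠` the branches of the binary tree of height `𝔠` give an almost disjoint family
of `2 ^ 𝔠` subsets of a set of cardinality `𝔠`. -/
theorem exists_almostDisjoint (hc : (2 : Cardinal.{u}) ^< 𝔠 = 𝔠) (ι κ : Type u) (hι : #ι = 𝔠)
    (hκ : #κ = 2 ^ (𝔠 : Cardinal.{u})) :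
    ∃ Y : κ → Set ι, (∀ k, #(Y k) = 𝔠) ∧ ∀ k l, k ≠ l → #(Y k ∩ Y l : Set ι) < 𝔠 := by
  let A : Type u := (𝔠 : Cardinal.{u}).ord.ToType
  have hA : #A = 𝔠 := mk_ord_toType _
  have hlt (a : A) : #(Set.Iio a) < 𝔠 := by
    simpa [A] using mk_Iio_lt a (by simp [A])
  let N : Type u := Σ a : A, (Set.Iio a → Bool)
  have hN : #N = 𝔠 := by
    refine le_antisymm ?_ ?_
    · rw [mk_sigma]
      calc sum (fun a : A => #(Set.Iio a → Bool)) ≤ sum (fun _ : A => (𝔠 : Cardinal.{u})) :=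
            sum_le_sum _ _ fun a => by
              rw [mk_arrow, mk_bool, lift_ofNat, lift_uzero]
              exact (le_powerlt 2 (hlt a)).trans hc.le
        _ = 𝔠 := by rw [sum_const', hA, continuum_mul_self]
    · rw [← hA]
      exact mk_le_of_injective (f := fun a : A => (⟨a, fun _ => true⟩ : N))
        fun a b h => (Sigma.mk.inj_iff.1 h).1
  obtain ⟨e⟩ : Nonempty (N ≃ ι) := Cardinal.eq.1 (hN.trans hι.symm)
  obtain ⟨b⟩ : Nonempty (κ ≃ (A → Bool)) := Cardinal.eq.1 (by
    rw [hκ, mk_arrow, mk_bool, lift_ofNat, lift_uzero, hA])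
  -- `β f a` is the node of level `a` on the branch `f`. Equal nodes have equal level, so two
  -- branches share no node above a level where they differ.
  let β (f : A → Bool) (a : A) : ι := e ⟨a, fun x => f x⟩
  have hβ (f : A → Bool) : Function.Injective (β f) := fun a a' h =>
    (Sigma.mk.inj_iff.1 (e.injective h)).1
  refine ⟨fun k => Set.range (β (b k)), fun k => ?_, fun k l hkl => ?_⟩
  · rw [mk_range_eq _ (hβ _), hA]
  · obtain ⟨x, hx⟩ := Function.ne_iff.1 (b.injective.ne hkl)
    refine lt_of_le_of_lt (mk_le_mk_of_subset
      (t := β (b k) '' insert x (Set.Iio x)) ?_) (lt_of_le_of_lt mk_image_le ?_)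
    · rintro _ ⟨⟨a, rfl⟩, ⟨a', h⟩⟩
      refine ⟨a, ?_, rfl⟩
      by_contra hax
      have hxa : x < a := by
        simp only [Set.mem_insert_iff, Set.mem_Iio, not_or, not_lt] at hax
        exact lt_of_le_of_ne hax.2 (Ne.symm hax.1)
      have h' := e.injective h
      obtain rfl : a' = a := (Sigma.mk.inj_iff.1 h').1
      have := congrFun (eq_of_heq (Sigma.mk.inj_iff.1 h').2) ⟨x, hxa⟩
      exact hx this.symm
    · exact (mk_insert_le).trans_lt (add_lt_of_lt aleph0_le_continuum (hlt x)
        (one_lt_aleph0.trans_le aleph0_le_continuum))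

/-- There is an independent family of size `𝔠` in the circle. -/
theorem exists_linearIndependent_unitAddCircle (ι : Type u) (hι : #ι = 𝔠) :
    ∃ t : ι → UnitAddCircle, LinearIndependent ℤ t := by
  -- In a Hamel basis containing `1`, the remaining elements stay independent modulo `ℤ`: the kernel
  -- of the projection to the circle lies in the span of `1`, which meets theirs trivially.
  have h1 : LinearIndepOn ℚ id ({1} : Set ℝ) := LinearIndepOn.singleton one_ne_zero
  let b := Module.Basis.extend h1
  let S : Set ℝ := h1.extend (Set.subset_univ _)
  have hS1 : (1 : ℝ) ∈ S := h1.subset_extend _ rfl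
  have hli : LinearIndependent ℚ ((↑) : S → ℝ) := h1.linearIndepOn_extend _
  have hScard : #S = 𝔠 := by
    have h2 : Module.rank ℚ ℝ = 𝔠 := by
      exact Real.rank_rat_real
    rw [← h2]
    exact b.mk_eq_rank''
  have hℤ : LinearIndependent ℤ ((↑) : S → ℝ) := hli.restrict_scalars' ℤ
  let o : S := ⟨1, hS1⟩
  have hcompl : #({o}ᶜ : Set S) = 𝔠 := by
    have : Infinite S := by
      rw [infinite_iff, hScard]; exact aleph0_le_continuum
    rw [mk_compl_of_infinite _ (by simpa [hScard] using one_lt_aleph0.trans aleph0_lt_continuum),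
      hScard]
  obtain ⟨e⟩ : Nonempty (ι ≃ ({o}ᶜ : Set S)) := by
    rw [← lift_mk_eq', hι, hcompl]; simp
  let f : ℝ →ₗ[ℤ] UnitAddCircle :=
    (QuotientAddGroup.mk' (AddSubgroup.zmultiples (1 : ℝ))).toIntLinearMap
  have hd := hℤ.disjoint_span_image (s := {o}ᶜ) (t := {o}) disjoint_compl_left
  refine ⟨fun i => f (e i : S), ?_⟩
  have h3 : LinearIndependent ℤ (fun i => ((e i : S) : ℝ)) :=
    hℤ.comp (fun i => (e i : S)) (Subtype.val_injective.comp e.injective)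
  refine h3.map (hd.mono (Submodule.span_mono ?_) ?_)
  · rintro _ ⟨i, rfl⟩
    exact ⟨e i, (e i).2, rfl⟩
  · intro x hx
    obtain ⟨n, hn⟩ := (QuotientAddGroup.eq_zero_iff x).1
      (show ((x : ℝ) : UnitAddCircle) = 0 from hx)
    rw [← hn]
    exact Submodule.smul_mem _ n (Submodule.subset_span ⟨o, rfl, rfl⟩)

/-! ### Weight, precompactness and characters -/

theorem exists_basis_eq_topWeight (X : Type u) [TopologicalSpace X] :
    ∃ B : Set (Set X), TopologicalSpace.IsTopologicalBasis B ∧ #B = topWeight X :=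
  csInf_mem (s := {k : Cardinal.{u} | ∃ B : Set (Set X),
    TopologicalSpace.IsTopologicalBasis B ∧ #B = k})
    ⟨_, _, TopologicalSpace.isTopologicalBasis_opens, rfl⟩

theorem topWeight_le_two_power (X : Type u) [TopologicalSpace X] : topWeight X ≤ 2 ^ #X :=
  (csInf_le' ⟨_, TopologicalSpace.isTopologicalBasis_opens, rfl⟩ : topWeight X ≤ _).trans
    ((mk_set_le _).trans (mk_set (α := X)).le)

theorem IsPrecompactAddGroup.quotient {X : Type u} [AddCommGroup X] [TopologicalSpace X]
    [IsTopologicalAddGroup X] (hX : IsPrecompactAddGroup X) (N : AddSubgroup X) :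
    IsPrecompactAddGroup (X ⧸ N) := by
  intro U hU
  obtain ⟨F, hF, h⟩ := hX ((QuotientAddGroup.mk : X → X ⧸ N) ⁻¹' U)
    (QuotientAddGroup.continuous_mk.continuousAt hU)
  refine ⟨QuotientAddGroup.mk '' F, hF.image _, Set.eq_univ_of_forall fun q => ?_⟩
  obtain ⟨x, rfl⟩ := QuotientAddGroup.mk_surjective q
  obtain ⟨a, ha, y, hy, rfl⟩ := Set.mem_add.1 (h.symm ▸ Set.mem_univ x : x ∈ F + _)
  exact Set.mem_add.2 ⟨_, ⟨a, ha, rfl⟩, _, hy, rfl⟩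

/-- Subgroups of compact groups are precompact. -/
theorem isPrecompactAddGroup_of_compactSpace {P : Type u} [AddCommGroup P] [TopologicalSpace P]
    [IsTopologicalAddGroup P] [CompactSpace P] (H : AddSubgroup P) : IsPrecompactAddGroup H := by
  classical
  intro U hU
  obtain ⟨V, hV, hVU⟩ := mem_nhds_subtype _ _ _ |>.1 hU
  obtain ⟨W, hW, hWV⟩ := exists_nhds_half_neg hV
  obtain ⟨t, -, ht⟩ := isCompact_univ.elim_nhds_subcover (fun p : P => (fun x => x - p) ⁻¹' W)
    fun p _ => (continuous_id.sub continuous_const).continuousAt.preimage_mem_nhds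
      (by simpa using hW)
  -- The centres `p` need not lie in `H`, so each is replaced by a point of `H` in its translate of
  -- `W`; the value `0` is only a filler for translates missing `H`.
  let c (p : P) : H := if h : ∃ x : H, (x : P) - p ∈ W then h.choose else 0
  refine ⟨c '' t, t.finite_toSet.image _, Set.eq_univ_of_forall fun x => ?_⟩
  obtain ⟨p, hp, hx⟩ := Set.mem_iUnion₂.1 (ht (Set.mem_univ (x : P)))
  have hex : ∃ x : H, (x : P) - p ∈ W := ⟨x, hx⟩
  have hc : (c p : P) - p ∈ W := by
    simp only [c, dif_pos hex]
    exact hex.choose_spec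
  refine Set.mem_add.2 ⟨c p, ⟨p, hp, rfl⟩, x - c p, hVU ?_, by abel⟩
  have := hWV _ hx _ hc
  simpa using this

/-- The representative of absolute value at most `1 / 4` doubles to one of absolute value at most `1
/ 2`, still the nearest to zero. Iteration shows that the circle has no small subgroups. -/
theorem UnitAddCircle.norm_two_nsmul {z : UnitAddCircle} (hz : ‖z‖ ≤ 1 / 4) :
    ‖(2 : ℕ) • z‖ = 2 * ‖z‖ := by
  obtain ⟨r, rfl⟩ := QuotientAddGroup.mk_surjective z
  have hs : ((r - round r : ℝ) : UnitAddCircle) = r := by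
    rw [AddCircle.coe_sub, sub_eq_self]
    exact AddCircle.coe_eq_zero_iff 1 |>.2 ⟨round r, by simp⟩
  change ‖(r : UnitAddCircle)‖ ≤ 1 / 4 at hz
  change ‖(2 : ℕ) • (r : UnitAddCircle)‖ = 2 * ‖(r : UnitAddCircle)‖
  have hr : ‖(r : UnitAddCircle)‖ = |r - round r| := UnitAddCircle.norm_eq
  rw [hr] at hz ⊢
  rw [← hs, ← AddCircle.coe_nsmul, (AddCircle.norm_coe_eq_abs_iff 1 one_ne_zero).2]
  · simp [abs_mul]
  · simp only [nsmul_eq_mul, Nat.cast_ofNat, abs_mul, abs_two, abs_one]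
    linarith

/-- A homomorphism to the circle with small values is trivial. -/
theorem AddMonoidHom.eq_zero_of_norm_lt {X : Type*} [AddCommGroup X] (ψ : X →+ UnitAddCircle)
    (h : ∀ x, ‖ψ x‖ < 1 / 4) : ψ = 0 := by
  ext x
  have key (n : ℕ) : ‖ψ (2 ^ n • x)‖ = 2 ^ n * ‖ψ x‖ := by
    induction n with
    | zero => simp
    | succ n ih =>
      rw [pow_succ', mul_smul, map_nsmul, UnitAddCircle.norm_two_nsmul (h _).le, ih]
      ring
  by_contra hx
  have hpos : 0 < ‖ψ x‖ := norm_pos_iff.2 hx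
  obtain ⟨n, hn⟩ := pow_unbounded_of_one_lt (1 / ‖ψ x‖) one_lt_two
  have h1 := h (2 ^ n • x)
  rw [key] at h1
  rw [div_lt_iff₀ hpos] at hn
  linarith

/-- A precompact group has at most as many continuous characters as its weight. -/
theorem mk_le_topWeight_of_characters {X α : Type u} [AddCommGroup X] [TopologicalSpace X]
    [IsTopologicalAddGroup X] (hX : IsPrecompactAddGroup X) (χ : α → X →+ UnitAddCircle)
    (hχ : ∀ a, Continuous (χ a)) (hinj : Function.Injective χ) :
    #α ≤ topWeight X * ℵ₀ := by
  obtain ⟨B, hB, hcard⟩ := exists_basis_eq_topWeight X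
  -- The map `a ↦ b a` will have finite fibres. Two characters sharing `b a = s` and a `1 /
  -- 24`-approximation on `F` differ by less than `1 / 12` on `F` and by less than `1 / 12 + 1 / 12`
  -- on `s`, hence by less than `1 / 4` on `F + s`.
  have hex (a : α) : ∃ b ∈ B, (0 : X) ∈ b ∧ b ⊆ {x | ‖χ a x‖ < 1 / 12} :=
    hB.mem_nhds_iff.1 ((isOpen_lt ((hχ a).norm) continuous_const).mem_nhds (by simp))
  choose b hbB h0 hb using hex
  rw [← hcard]
  refine mk_le_mk_mul_of_mk_preimage_le (fun a => (⟨b a, hbB a⟩ : B)) fun ⟨s, hs⟩ => ?_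
  let S := (fun a => (⟨b a, hbB a⟩ : B)) ⁻¹' {⟨s, hs⟩}
  have hS (a : S) : b a = s := congrArg Subtype.val (show (⟨b a, hbB a⟩ : B) = ⟨s, hs⟩ from a.2)
  suffices Finite S from (mk_le_aleph0_iff.2 inferInstance)
  cases isEmpty_or_nonempty S with
  | inl h => infer_instance
  | inr h =>
    obtain ⟨a₀⟩ := h
    have hs0 : s ∈ 𝓝 (0 : X) := hB.mem_nhds hs (hS a₀ ▸ h0 a₀)
    obtain ⟨F, hF, hFs⟩ := hX s hs0
    have : Fintype F := hF.fintype
    obtain ⟨t, -, htf, ht⟩ := Metric.finite_approx_of_totallyBounded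
      (isCompact_univ (X := F → UnitAddCircle)).totallyBounded (1 / 24) (by norm_num)
    have hg (a : S) : ∃ y ∈ t, dist (fun f : F => χ a f) y < 1 / 24 := by
      simpa using ht (Set.mem_univ (fun f : F => χ a f))
    choose g hgt hg using hg
    have : Finite t := htf
    refine Finite.of_injective (fun a => (⟨g a, hgt a⟩ : t)) fun a a' haa => ?_
    have haa' : g a = g a' := congrArg Subtype.val haa
    refine Subtype.ext (hinj (sub_eq_zero.1 (AddMonoidHom.eq_zero_of_norm_lt _ fun x => ?_)))
    obtain ⟨f, hf, y, hy, rfl⟩ := Set.mem_add.1 (hFs.symm ▸ Set.mem_univ x : x ∈ F + s)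
    have h1 := hb a ((hS a).symm ▸ hy)
    have h2 := hb a' ((hS a').symm ▸ hy)
    have h3 := (dist_le_pi_dist (fun f : F => χ a f) (g a) ⟨f, hf⟩).trans_lt (hg a)
    have h4 := (dist_le_pi_dist (fun f : F => χ a' f) (g a') ⟨f, hf⟩).trans_lt (hg a')
    rw [haa'] at h3
    have h5 := (dist_triangle_right (χ a f) (χ a' f) (g a' ⟨f, hf⟩)).trans_lt (add_lt_add h3 h4)
    rw [dist_eq_norm] at h5
    simp only [Set.mem_ofPred_eq] at h1 h2
    calc ‖(χ a - χ a') (f + y)‖ = ‖(χ a f - χ a' f) + (χ a y - χ a' y)‖ := by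
          simp only [AddMonoidHom.sub_apply, map_add]
      _ ≤ ‖χ a f - χ a' f‖ + (‖χ a y‖ + ‖χ a' y‖) :=
          (norm_add_le _ _).trans (add_le_add_right (norm_sub_le _ _) _)
      _ < 1 / 4 := by linarith

/-! ### Infinite quotients of size at most the continuum -/

/-- Every infinite precompact Hausdorff abelian group has an infinite quotient of cardinality at
most `𝔠`. -/
theorem exists_infinite_quotient_mk_le_continuum (G : Type u) [AddCommGroup G] [TopologicalSpace G]
    [IsTopologicalAddGroup G] [T2Space G] [Infinite G] (hG : IsPrecompactAddGroup G) :
    ∃ N : AddSubgroup G, IsClosed (N : Set G) ∧ Infinite (G ⧸ N) ∧ #(G ⧸ N) ≤ 𝔠 := by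
  let x := Infinite.natEmbedding G
  -- Shrinking under differences makes the intersection a subgroup; avoiding the differences of the
  -- first `n` terms keeps the `x i` distinct modulo it.
  have step (U : {U : Set G // U ∈ 𝓝 0 ∧ IsClosed U}) (n : ℕ) :
      ∃ V : {U : Set G // U ∈ 𝓝 0 ∧ IsClosed U}, (∀ v ∈ V.1, ∀ w ∈ V.1, v - w ∈ U.1) ∧
        ∀ i < n, ∀ j < n, i ≠ j → x i - x j ∉ V.1 := by
    obtain ⟨W, hW, hWU⟩ := exists_nhds_half_neg U.2.1
    let E : Set G := {z | ∃ p : Fin n × Fin n, p.1 ≠ p.2 ∧ x p.1 - x p.2 = z}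
    have hE : E.Finite := by
      refine (Set.finite_range (fun p : Fin n × Fin n => x p.1 - x p.2)).subset ?_
      rintro _ ⟨p, -, rfl⟩
      exact ⟨p, rfl⟩
    have h0 : (0 : G) ∉ E := by
      rintro ⟨p, hp, h⟩
      exact hp (Fin.ext (x.injective (sub_eq_zero.1 h)))
    obtain ⟨V, hV, hVc, hVW⟩ := exists_mem_nhds_isClosed_subset
      (Filter.inter_mem hW (hE.isClosed.isOpen_compl.mem_nhds h0))
    refine ⟨⟨V, hV, hVc⟩, fun v hv w hw => hWU v (hVW hv).1 w (hVW hw).1,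
      fun i hi j hj hij h => (hVW h).2 ⟨(⟨i, hi⟩, ⟨j, hj⟩), ?_, rfl⟩⟩
    simpa using hij
  choose s hs1 hs2 using step
  let U (n : ℕ) : {U : Set G // U ∈ 𝓝 0 ∧ IsClosed U} :=
    Nat.rec ⟨Set.univ, Filter.univ_mem, isClosed_univ⟩ (fun n U => s U n) n
  have h1 (n : ℕ) : ∀ v ∈ (U (n + 1)).1, ∀ w ∈ (U (n + 1)).1, v - w ∈ (U n).1 := hs1 (U n) n
  have h2 (n : ℕ) : ∀ i < n, ∀ j < n, i ≠ j → x i - x j ∉ (U (n + 1)).1 := hs2 (U n) n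
  have h0 (n : ℕ) : (0 : G) ∈ (U n).1 := mem_of_mem_nhds (U n).2.1
  have hneg {v : G} (hv : ∀ n, v ∈ (U n).1) (n : ℕ) : -v ∈ (U n).1 := by
    simpa using h1 n 0 (h0 (n + 1)) v (hv (n + 1))
  let N : AddSubgroup G :=
    { carrier := {v | ∀ n, v ∈ (U n).1}
      zero_mem' := h0
      add_mem' := fun {a b} ha hb n => by simpa using h1 n a (ha (n + 1)) (-b) (hneg hb (n + 1))
      neg_mem' := fun hv => hneg hv }
  refine ⟨N, ?_, ?_, ?_⟩
  · change IsClosed {v | ∀ n, v ∈ (U n).1}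
    rw [Set.ofPred_forall]
    exact isClosed_iInter fun n => (U n).2.2
  · refine Infinite.of_injective (fun i => (x i : G ⧸ N)) fun i j hij => ?_
    by_contra hne
    have := (QuotientAddGroup.eq.1 hij : _ ∈ N) (max i j + 1 + 1)
    rw [neg_add_eq_sub] at this
    exact h2 (max i j + 1) j (by omega) i (by omega) (Ne.symm hne) this
  · have hF (n : ℕ) : ∃ F : Set G, F.Finite ∧ F + (U n).1 = Set.univ := hG _ (U n).2.1
    choose F hFf hFU using hF
    have hf (n : ℕ) (g : G) : ∃ f : F n, g - f ∈ (U n).1 := by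
      obtain ⟨f, hf, y, hy, rfl⟩ := Set.mem_add.1 ((hFU n).symm ▸ Set.mem_univ g : g ∈ F n + _)
      exact ⟨⟨f, hf⟩, by simpa using hy⟩
    choose f hf using hf
    have hε (n : ℕ) : ∃ ε : F n → ℕ, Function.Injective ε :=
      have := (hFf n).to_subtype
      Countable.exists_injective_nat _
    choose ε hε using hε
    -- A coset is determined by the finite-cover centres chosen for its representative at every
    -- level, that is, by a sequence of naturals. Equal centres at level `n + 1` put the difference
    -- in `U n`.
    have hinj : Function.Injective fun (q : G ⧸ N) (n : ℕ) => ε n (f n q.out) := by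
      intro q q' h
      have hmem : q'.out - q.out ∈ N := fun n => by
        have e : f (n + 1) q.out = f (n + 1) q'.out := hε _ (congrFun h (n + 1))
        have := h1 n _ (hf (n + 1) q'.out) _ (hf (n + 1) q.out)
        rw [e] at this
        simpa using this
      rw [← QuotientAddGroup.out_eq' q, ← QuotientAddGroup.out_eq' q']
      exact QuotientAddGroup.eq.2 (by rwa [neg_add_eq_sub])
    have := lift_mk_le_lift_mk_of_injective hinj
    simpa using this

/-! ### Integral combinations and generated subgroups -/

theorem Finsupp.linearCombination_pi_apply {α β : Type*} (x : α → β → UnitAddCircle) (n : α →₀ ℤ)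
    (b : β) : Finsupp.linearCombination ℤ x n b =
      Finsupp.linearCombination ℤ (fun a => x a b) n :=
  Finsupp.apply_linearCombination ℤ (LinearMap.proj (φ := fun _ : β => UnitAddCircle) b) x n

/-- This symmetry is the duality between rows and columns: evaluating a row combination on a column
combination can be done from either side. -/
theorem Finsupp.linearCombination_swap {α β : Type*} (x : α → β → UnitAddCircle) (n : α →₀ ℤ)
    (m : β →₀ ℤ) :
    Finsupp.linearCombination ℤ (fun b => Finsupp.linearCombination ℤ (fun a => x a b) n) m =
      Finsupp.linearCombination ℤ (fun a => Finsupp.linearCombination ℤ (x a) m) n := by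
  simp only [Finsupp.linearCombination_apply, Finsupp.smul_sum]
  rw [Finsupp.sum_comm]
  exact Finsupp.sum_congr fun a _ => Finsupp.sum_congr fun b _ => smul_comm _ _ _

theorem Finsupp.continuous_linearCombination {α : Type*} (n : α →₀ ℤ) :
    Continuous fun v : α → UnitAddCircle => Finsupp.linearCombination ℤ v n := by
  simp only [Finsupp.linearCombination_apply, Finsupp.sum]
  fun_prop

theorem mem_generatedSubgroup_iff {α β : Type u} (x : α → β → UnitAddCircle)
    (g : β → UnitAddCircle) :
    g ∈ generatedSubgroup x ↔ ∃ n : α →₀ ℤ, Finsupp.linearCombination ℤ x n = g := by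
  rw [generatedSubgroup, ← Submodule.span_int_eq_addSubgroupClosure, Submodule.mem_toAddSubgroup,
    Finsupp.mem_span_range_iff_exists_finsupp]
  rfl

theorem mem_generatedSubgroup {α β : Type u} (x : α → β → UnitAddCircle) (a : α) :
    x a ∈ generatedSubgroup x :=
  AddSubgroup.subset_closure ⟨a, rfl⟩

theorem nonempty_equiv_generatedSubgroup {α β : Type u} {x : α → β → UnitAddCircle}
    (hx : LinearIndependent ℤ x) : Nonempty ((α →₀ ℤ) ≃ₗ[ℤ] generatedSubgroup x) := by
  refine ⟨LinearEquiv.ofBijective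
    (AddMonoidHom.toIntLinearMap ((Finsupp.linearCombination ℤ x).toAddMonoidHom.codRestrict
      (generatedSubgroup x) fun n => (mem_generatedSubgroup_iff x _).2 ⟨n, rfl⟩)) ⟨?_, ?_⟩⟩
  · intro n m h
    exact hx (congrArg Subtype.val h)
  · rintro ⟨g, hg⟩
    obtain ⟨n, rfl⟩ := (mem_generatedSubgroup_iff x g).1 hg
    exact ⟨n, rfl⟩

theorem free_generatedSubgroup {α β : Type u} {x : α → β → UnitAddCircle}
    (hx : LinearIndependent ℤ x) : Module.Free ℤ (generatedSubgroup x) :=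
  (nonempty_equiv_generatedSubgroup hx).elim fun e => Module.Free.of_equiv e

theorem mk_generatedSubgroup {α β : Type u} [Infinite α] {x : α → β → UnitAddCircle}
    (hx : LinearIndependent ℤ x) : #(generatedSubgroup x) = #α := by
  obtain ⟨e⟩ := nonempty_equiv_generatedSubgroup hx
  rw [← mk_congr e.toEquiv, mk_finsupp_lift_of_infinite]
  simp

theorem mk_iUnion_finset_lt {α β : Type u} {c : Cardinal.{u}} (hc : ℵ₀ ≤ c) (F : Finset α)
    (S : α → Set β) (hS : ∀ a ∈ F, #(S a) < c) : #(⋃ a ∈ F, S a : Set β) < c := by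
  classical
  induction F using Finset.induction_on with
  | empty => simpa using aleph0_pos.trans_le hc
  | insert a F ha ih =>
    rw [Finset.set_biUnion_insert]
    exact (mk_union_le _ _).trans_lt (add_lt_of_lt hc (hS a (Finset.mem_insert_self a F))
      (ih fun b hb => hS b (Finset.mem_insert_of_mem hb)))

theorem mk_unitAddCircle_le : #UnitAddCircle ≤ 𝔠 :=
  (mk_le_of_surjective (QuotientAddGroup.mk_surjective (s := AddSubgroup.zmultiples (1 : ℝ)))).trans
    mk_real.le

/-- The exponent in `(2 ^ ℵ₀) ^ #J = 2 ^ (ℵ₀ * #J)` is still below `𝔠`, so `2 ^< 𝔠 = 𝔠` applies. -/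
theorem mk_pi_unitAddCircle_le (hc : (2 : Cardinal.{u}) ^< 𝔠 = 𝔠) (J : Type u) (hJ : #J < 𝔠) :
    #(J → UnitAddCircle) ≤ 𝔠 := by
  rw [mk_arrow, lift_uzero]
  calc lift.{u} #UnitAddCircle ^ #J ≤ (2 ^ ℵ₀) ^ #J := by
        refine power_le_power_right ?_
        rw [two_power_aleph0, ← lift_continuum.{u, 0}]
        exact lift_le.2 mk_unitAddCircle_le
    _ = 2 ^ (ℵ₀ * #J) := by rw [power_mul]
    _ ≤ 2 ^< 𝔠 := le_powerlt 2 (mul_lt_of_lt aleph0_le_continuum aleph0_lt_continuum hJ)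
    _ = 𝔠 := hc

/-! ### The groups generated by the rows and by the columns -/

section AlmostDisjoint

variable {ι κ : Type u} {Y : κ → Set ι} (e : ∀ k, ι ≃ Y k) {t : ι → UnitAddCircle}

/-- An integral combination of reindexed points is arbitrary outside a small set of coordinates. -/
theorem exists_solution (hY : ∀ k l, k ≠ l → #(Y k ∩ Y l : Set ι) < 𝔠) (n : κ →₀ ℤ)
    (hn : n ≠ 0) : ∃ J : Set ι, #J < 𝔠 ∧ ∀ y : ι → UnitAddCircle, (∀ i ∈ J, y i = 0) →
      ∃ u : ι → UnitAddCircle, ∀ i, Finsupp.linearCombination ℤ (fun k => u (e k i)) n = y i := by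
  classical
  obtain ⟨k₀, hk₀⟩ := Finsupp.ne_iff.1 hn
  -- `J` collects the `i` whose image under `e k₀` lies in another `Y k` of the support; `e k₀`
  -- injects it into a finite union of small sets `Y k₀ ∩ Y k`.
  refine ⟨{i | ∃ k ∈ n.support.erase k₀, (e k₀ i : ι) ∈ Y k}, ?_, fun y hy => ?_⟩
  · refine lt_of_le_of_lt ?_ (mk_iUnion_finset_lt aleph0_le_continuum (n.support.erase k₀)
      (fun k => Y k₀ ∩ Y k) fun k hk => hY k₀ k (Finset.ne_of_mem_erase hk).symm)
    refine mk_le_of_injective (f := fun i => ⟨(e k₀ i.1 : ι), ?_⟩) fun i j hij => ?_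
    · obtain ⟨k, hk, h⟩ := i.2
      exact Set.mem_iUnion₂.2 ⟨k, hk, (e k₀ i.1).2, h⟩
    · exact Subtype.ext ((e k₀).injective (Subtype.ext (by simpa using hij)))
  · have hdiv (i : ι) : ∃ w : UnitAddCircle, n k₀ • w = y i :=
      ⟨DivisibleBy.div (y i) (n k₀), DivisibleBy.div_cancel _ hk₀⟩
    choose w hw using hdiv
    -- Supported on the part of `Y k₀` that misses the other `Y k`, `u` leaves only the `k₀` term in
    -- each combination; divisibility of the circle solves for it.
    let u (j : ι) : UnitAddCircle :=
      if h : j ∈ Y k₀ ∧ ∀ k ∈ n.support.erase k₀, j ∉ Y k then w ((e k₀).symm ⟨j, h.1⟩) else 0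
    refine ⟨u, fun i => ?_⟩
    rw [Finsupp.linearCombination_apply, Finsupp.sum, Finset.sum_eq_single k₀]
    · by_cases h : ∃ k ∈ n.support.erase k₀, (e k₀ i : ι) ∈ Y k
      · have : u (e k₀ i) = 0 := dif_neg fun h' => by
          obtain ⟨k, hk, hm⟩ := h
          exact h'.2 k hk hm
        rw [this, smul_zero, hy i h]
      · push Not at h
        have : u (e k₀ i) = w i := by
          simp only [u]
          rw [dif_pos ⟨(e k₀ i).2, h⟩]
          simp
        rw [this, hw]
    · intro k hk hne
      have : u (e k i) = 0 := dif_neg fun h' =>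
        h'.2 k (Finset.mem_erase.2 ⟨hne, hk⟩) (e k i).2
      rw [this, smul_zero]
    · intro h
      rw [Finsupp.notMem_support_iff.1 h, zero_smul]

/-- A closed set containing the multiples of a combination of reindexed copies of an independent
point contains the combinations of all reindexed points. -/
theorem mem_of_isClosed_of_multiples (ht : LinearIndependent ℤ t) (n : κ →₀ ℤ)
    {C : Set (ι → UnitAddCircle)} (hC : IsClosed C)
    (h : ∀ a : ℤ, a • Finsupp.linearCombination ℤ (fun k i => t (e k i)) n ∈ C)
    (u : ι → UnitAddCircle) :
    (fun i => Finsupp.linearCombination ℤ (fun k => u (e k i)) n) ∈ C := by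
  let φ (v : ι → UnitAddCircle) (i : ι) := Finsupp.linearCombination ℤ (fun k => v (e k i)) n
  have hφ : Continuous φ := continuous_pi fun i =>
    (Finsupp.continuous_linearCombination n).comp (by fun_prop)
  have hcl : IsClosed (φ ⁻¹' C) := hC.preimage hφ
  have hsub : (AddSubgroup.zmultiples t : Set (ι → UnitAddCircle)) ⊆ φ ⁻¹' C := by
    rintro _ ⟨a, rfl⟩
    have : φ (a • t) = a • Finsupp.linearCombination ℤ (fun k i => t (e k i)) n := by
      ext i
      rw [Pi.smul_apply, Finsupp.linearCombination_pi_apply]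
      simp [φ, Finsupp.linearCombination_apply, Finsupp.smul_sum, smul_comm a]
    exact Set.mem_preimage.2 (this ▸ h a)
  exact hcl.closure_subset_iff.2 hsub (dense_zmultiples_of_linearIndependent ht u)

/-- A relation between rows would place the image of `φ` in the closed set `{0}`, whereas
`exists_solution` realises a non-zero value at any coordinate outside `J`; one exists since `#J <
𝔠`. -/
theorem linearIndependent_rows (hι : #ι = 𝔠) (ht : LinearIndependent ℤ t)
    (hY : ∀ k l, k ≠ l → #(Y k ∩ Y l : Set ι) < 𝔠) :
    LinearIndependent ℤ fun (k : κ) (i : ι) => t (e k i) := by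
  classical
  refine linearIndependent_iff.2 fun n hn => ?_
  by_contra h0
  obtain ⟨J, hJ, hu⟩ := exists_solution e hY n h0
  obtain ⟨i, hi⟩ : ∃ i, i ∉ J := by
    by_contra! h
    rw [Set.eq_univ_of_forall h, mk_univ, hι] at hJ
    exact hJ.false
  obtain ⟨u, hu⟩ := hu (Pi.single i (t i)) fun j hj =>
    Pi.single_eq_of_ne (M := fun _ => UnitAddCircle) (fun h : j = i => hi (h ▸ hj)) (t i)
  have := mem_of_isClosed_of_multiples e ht n (isClosed_singleton (x := 0)) (by simp [hn]) u
  refine ht.ne_zero i ?_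
  rw [← Pi.single_eq_same (M := fun _ => UnitAddCircle) i (t i), ← hu i]
  exact congrFun this i

theorem linearIndependent_columns [Nonempty κ] (ht : LinearIndependent ℤ t) :
    LinearIndependent ℤ fun (i : ι) (k : κ) => t (e k i) := by
  obtain ⟨k⟩ := ‹Nonempty κ›
  exact LinearIndependent.of_comp (LinearMap.proj (φ := fun _ : κ => UnitAddCircle) k)
    (ht.comp (fun i => (e k i : ι)) (Subtype.val_injective.comp (e k).injective))

theorem dense_rows [Nonempty κ] (ht : LinearIndependent ℤ t) :
    Dense (generatedSubgroup (fun (k : κ) (i : ι) => t (e k i)) : Set (ι → UnitAddCircle)) := by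
  obtain ⟨k⟩ := ‹Nonempty κ›
  have h := dense_zmultiples_of_linearIndependent
    (ht.comp (fun i => (e k i : ι)) (Subtype.val_injective.comp (e k).injective))
  refine h.mono ?_
  exact AddSubgroup.zmultiples_le_of_mem
    (mem_generatedSubgroup (fun (k : κ) (i : ι) => t (e k i)) k)

/-- A character killing every column is an integral relation between the rows. -/
theorem dense_columns (hx : LinearIndependent ℤ fun (k : κ) (i : ι) => t (e k i)) :
    Dense (generatedSubgroup (fun (i : ι) (k : κ) => t (e k i)) : Set (κ → UnitAddCircle)) := by
  refine dense_of_annihilator_trivial _ fun n hn => linearIndependent_iff.1 hx n ?_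
  ext i
  rw [Finsupp.linearCombination_pi_apply]
  exact hn _ (mem_generatedSubgroup (fun (i : ι) (k : κ) => t (e k i)) i)

/-- `B` contains the kernel of restriction to `J`, which has index at most `𝔠` in a group of size `2
^ 𝔠`. -/
theorem mk_closed_subgroup_rows (hc : (2 : Cardinal.{u}) ^< 𝔠 = 𝔠) (ht : LinearIndependent ℤ t)
    (hY : ∀ k l, k ≠ l → #(Y k ∩ Y l : Set ι) < 𝔠)
    (hG : #(generatedSubgroup fun (k : κ) (i : ι) => t (e k i)) = 2 ^ (𝔠 : Cardinal.{u}))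
    (B : AddSubgroup (generatedSubgroup fun (k : κ) (i : ι) => t (e k i)))
    (hB : IsClosed (B : Set (generatedSubgroup fun (k : κ) (i : ι) => t (e k i)))) (hB0 : B ≠ ⊥) :
    #B = 2 ^ (𝔠 : Cardinal.{u}) := by
  obtain ⟨⟨b, hbG⟩, hb, hb0⟩ := B.bot_or_exists_ne_zero.resolve_left hB0
  obtain ⟨n, rfl⟩ := (mem_generatedSubgroup_iff _ _).1 hbG
  have hn : n ≠ 0 := by
    rintro rfl
    exact hb0 (Subtype.ext (map_zero _))
  obtain ⟨J, hJ, hu⟩ := exists_solution e hY n hn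
  let r : (generatedSubgroup fun (k : κ) (i : ι) => t (e k i)) →+ (J → UnitAddCircle) :=
    { toFun := fun g j => g.1 j
      map_zero' := rfl
      map_add' := fun _ _ => rfl }
  obtain ⟨C, hC, hCB⟩ := isClosed_induced_iff.1 hB
  have hker : r.ker ≤ B := fun g hg => by
    obtain ⟨u, hu⟩ := hu g.1 fun j hj => congrFun hg ⟨j, hj⟩
    have := mem_of_isClosed_of_multiples e ht n hC (fun a => by
      have : a • (⟨_, hbG⟩ : generatedSubgroup fun (k : κ) (i : ι) => t (e k i)) ∈
        (B : Set (generatedSubgroup fun (k : κ) (i : ι) => t (e k i))) := B.zsmul_mem hb a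
      rw [← hCB] at this
      exact this) u
    rw [funext hu] at this
    change g ∈ (B : Set (generatedSubgroup fun (k : κ) (i : ι) => t (e k i)))
    rw [← hCB]
    exact this
  refine le_antisymm (hG ▸ mk_subtype_le _) (le_trans ?_ (mk_le_mk_of_subset hker))
  by_contra! hlt
  have h1 : #((generatedSubgroup fun (k : κ) (i : ι) => t (e k i)) ⧸ r.ker) ≤ 𝔠 :=
    (mk_le_of_injective (QuotientAddGroup.kerLift_injective r)).trans
      (mk_pi_unitAddCircle_le hc J hJ)
  have h2 := mk_congr (AddSubgroup.addGroupEquivQuotientProdAddSubgroup (s := r.ker))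
  rw [hG, mk_prod, lift_id, lift_id] at h2
  exact (mul_lt_of_lt (aleph0_le_continuum.trans (cantor _).le) (h1.trans_lt (cantor _)) hlt).ne
    h2.symm

/-- A point of norm `(1 / 2) ^ m` is killed by `2 ^ m`, so no coordinate of an element of `H` has
that norm. Applied to `h - a`, this makes the coordinate balls of radius `(1 / 2) ^ m` around points
of `H` closed in `H` as well as open. -/
theorem isZeroDimensional_of_torsionFree (H : AddSubgroup (κ → UnitAddCircle))
    (hH : ∀ h ∈ H, ∀ k, ∀ n : ℕ, n ≠ 0 → n • h k = 0 → h k = 0) : IsZeroDimensional H := by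
  have hne (h : H) (k : κ) (m : ℕ) : ‖h.1 k‖ ≠ (1 / 2) ^ m := by
    intro heq
    have hpos : (0 : ℝ) < (1 / 2) ^ m := by positivity
    have h0 : h.1 k = 0 := by
      refine hH h.1 h.2 k (2 ^ m) (by positivity) ?_
      obtain ⟨r, hr⟩ := QuotientAddGroup.mk_surjective (h.1 k)
      have hr' : (r : UnitAddCircle) = h.1 k := hr
      have hn : ‖(r : UnitAddCircle)‖ = |r - round r| := UnitAddCircle.norm_eq
      rw [hr', heq] at hn
      rw [← hr', ← AddCircle.coe_nsmul, AddCircle.coe_eq_zero_iff]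
      have hpow : (2 : ℝ) ^ m * (1 / 2) ^ m = 1 := by rw [← mul_pow]; norm_num
      rcases abs_cases (r - round r) with ⟨h1, -⟩ | ⟨h1, -⟩
      · refine ⟨2 ^ m * round r + 1, ?_⟩
        have : r = round r + (1 / 2) ^ m := by linarith
        simp only [zsmul_eq_mul, nsmul_eq_mul, Int.cast_add, Int.cast_mul, Int.cast_pow,
          Int.cast_ofNat, Int.cast_one, mul_one, Nat.cast_pow, Nat.cast_ofNat]
        nlinarith
      · refine ⟨2 ^ m * round r - 1, ?_⟩
        have : r = round r - (1 / 2) ^ m := by linarith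
        simp only [zsmul_eq_mul, nsmul_eq_mul, Int.cast_sub, Int.cast_mul, Int.cast_pow,
          Int.cast_ofNat, Int.cast_one, mul_one, Nat.cast_pow, Nat.cast_ofNat]
        nlinarith
    rw [h0, norm_zero] at heq
    exact hpos.ne heq
  refine TopologicalSpace.isTopologicalBasis_of_isOpen_of_nhds (fun s hs => hs.isOpen)
    fun a U ha hU => ?_
  obtain ⟨O, hO, rfl⟩ := isOpen_induced_iff.1 hU
  obtain ⟨F, u, hu, hF⟩ := isOpen_pi_iff.1 hO a.1 ha
  have hm (k : κ) : ∃ m : ℕ, k ∈ F → Metric.ball (a.1 k) ((1 / 2) ^ m) ⊆ u k := by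
    by_cases hk : k ∈ F
    · obtain ⟨ε, hε, hb⟩ := Metric.isOpen_iff.1 (hu k hk).1 _ (hu k hk).2
      obtain ⟨m, hm⟩ := exists_pow_lt_of_lt_one hε (one_half_lt_one (α := ℝ))
      exact ⟨m, fun _ => (Metric.ball_subset_ball hm.le).trans hb⟩
    · exact ⟨0, fun h => absurd h hk⟩
  choose m hm using hm
  have hcont (k : κ) : Continuous fun h : H => ‖h.1 k - a.1 k‖ :=
    (((continuous_apply k).comp continuous_subtype_val).sub continuous_const).norm
  refine ⟨⋂ k ∈ F, {h : H | ‖h.1 k - a.1 k‖ < (1 / 2) ^ m k},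
    F.finite_toSet.isClopen_biInter fun k _ => ⟨?_, ?_⟩, ?_, fun h hh => hF fun k hk => ?_⟩
  · have : {h : H | ‖h.1 k - a.1 k‖ < (1 / 2) ^ m k} =
        {h : H | ‖h.1 k - a.1 k‖ ≤ (1 / 2) ^ m k} :=
      Set.ext fun h => lt_iff_le_and_ne.trans (and_iff_left (hne (h - a) k _))
    rw [this]
    exact isClosed_le (hcont k) continuous_const
  · exact isOpen_lt (hcont k) continuous_const
  · simp
  · have := Set.mem_iInter₂.1 hh k hk
    exact hm k hk (mem_ball_iff_norm.2 this)

theorem isZeroDimensional_columns (ht : LinearIndependent ℤ t) :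
    IsZeroDimensional (generatedSubgroup fun (i : ι) (k : κ) => t (e k i)) := by
  refine isZeroDimensional_of_torsionFree _ fun h hh k n hn hnk => ?_
  obtain ⟨m, rfl⟩ := (mem_generatedSubgroup_iff _ _).1 hh
  rw [Finsupp.linearCombination_pi_apply] at hnk ⊢
  have hli := ht.comp (fun i => (e k i : ι)) (Subtype.val_injective.comp (e k).injective)
  rw [← map_nsmul] at hnk
  have := linearIndependent_iff.1 hli _ hnk
  rw [(smul_eq_zero.1 this).resolve_left hn, map_zero]

/-- Closed proper subgroups of a dense subgroup of a torus are annihilated by a non-trivial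
character. -/
theorem exists_annihilator {H : AddSubgroup (κ → UnitAddCircle)} (N : AddSubgroup H)
    (hN : IsClosed (N : Set H)) (hN' : N ≠ ⊤) :
    ∃ n : κ →₀ ℤ, n ≠ 0 ∧ ∀ h ∈ N, Finsupp.linearCombination ℤ h.1 n = 0 := by
  by_contra! hcon
  -- With no annihilating character, `N` is dense in the whole torus, so being closed in `H` it is
  -- all of `H`.
  have hd : Dense (N.map H.subtype : Set (κ → UnitAddCircle)) := by
    refine dense_of_annihilator_trivial _ fun n hn => ?_
    by_contra h0
    obtain ⟨h, hh, hne⟩ := hcon n h0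
    exact hne (hn h.1 ⟨h, hh, rfl⟩)
  obtain ⟨C, hC, hCN⟩ := isClosed_induced_iff.1 hN
  refine hN' (top_le_iff.1 fun h _ => ?_)
  change h ∈ (N : Set H)
  rw [← hCN]
  refine hC.closure_subset_iff.2 ?_ (hd h.1)
  rintro _ ⟨g, hg, rfl⟩
  rw [SetLike.mem_coe, ← SetLike.mem_coe, ← hCN] at hg
  exact hg

/-- The annihilator of `N` in the row group is closed and non-trivial, so `hG` makes it large; its
elements descend to distinct continuous characters of the quotient. -/
theorem topWeight_quotient_columns {x : κ → ι → UnitAddCircle} {z : ι → κ → UnitAddCircle}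
    (hxz : ∀ i k, z i k = x k i) (hx : LinearIndependent ℤ x)
    (hG : ∀ B : AddSubgroup (generatedSubgroup x),
      IsClosed (B : Set (generatedSubgroup x)) → B ≠ ⊥ → #B = 2 ^ (𝔠 : Cardinal.{u}))
    (N : AddSubgroup (generatedSubgroup z)) (hN : IsClosed (N : Set (generatedSubgroup z)))
    (hN' : N ≠ ⊤) : ¬ topWeight (generatedSubgroup z ⧸ N) < 2 ^ (𝔠 : Cardinal.{u}) := by
  have hswap (n : κ →₀ ℤ) (m : ι →₀ ℤ) :
      Finsupp.linearCombination ℤ (Finsupp.linearCombination ℤ x n) m =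
        Finsupp.linearCombination ℤ (Finsupp.linearCombination ℤ z m) n := by
    rw [show Finsupp.linearCombination ℤ x n = _ from
        funext fun i => Finsupp.linearCombination_pi_apply x n i,
      show Finsupp.linearCombination ℤ z m = _ from
        funext fun k => Finsupp.linearCombination_pi_apply z m k]
    simp only [hxz]
    exact Finsupp.linearCombination_swap x n m
  -- Pairing `g` with `h ∈ N` through coefficients of `h` over the columns makes each condition a
  -- closed one on `g`.
  let B : AddSubgroup (generatedSubgroup x) :=
    { carrier := {g | ∀ m : ι →₀ ℤ, ∀ h ∈ N, h.1 = Finsupp.linearCombination ℤ z m →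
        Finsupp.linearCombination ℤ g.1 m = 0}
      zero_mem' := fun m _ _ _ => by simp
      add_mem' := fun {a b} ha hb m h hh hm => by
        have h1 := ha m h hh hm
        have h2 := hb m h hh hm
        simp only [Finsupp.linearCombination_apply] at h1 h2 ⊢
        simp [smul_add, Finsupp.sum_add, h1, h2]
      neg_mem' := fun {a} ha m h hh hm => by
        have h1 := ha m h hh hm
        simp only [Finsupp.linearCombination_apply] at h1 ⊢
        simp [smul_neg, Finsupp.sum_neg, h1] }
  have hBc : IsClosed (B : Set (generatedSubgroup x)) := by
    change IsClosed {g : generatedSubgroup x | ∀ m : ι →₀ ℤ, ∀ h ∈ N,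
      h.1 = Finsupp.linearCombination ℤ z m → Finsupp.linearCombination ℤ g.1 m = 0}
    simp only [Set.ofPred_forall]
    exact isClosed_iInter fun m => isClosed_iInter fun h => isClosed_iInter fun _ =>
      isClosed_iInter fun _ => isClosed_eq
        ((Finsupp.continuous_linearCombination m).comp continuous_subtype_val) continuous_const
  have hB0 : B ≠ ⊥ := by
    obtain ⟨n, hn, hnN⟩ := exists_annihilator N hN hN'
    intro hbot
    have hmem : (⟨Finsupp.linearCombination ℤ x n, (mem_generatedSubgroup_iff x _).2 ⟨n, rfl⟩⟩ :
        generatedSubgroup x) ∈ B := fun m h hh hm => by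
      rw [hswap, ← hm, hnN h hh]
    rw [hbot, AddSubgroup.mem_bot] at hmem
    exact hn (linearIndependent_iff.1 hx n (congrArg Subtype.val hmem))
  have hn (g : B) : ∃ n : κ →₀ ℤ, Finsupp.linearCombination ℤ x n = g.1.1 :=
    (mem_generatedSubgroup_iff x _).1 g.1.2
  choose n hn using hn
  let ψ (g : B) : generatedSubgroup z →+ UnitAddCircle :=
    { toFun := fun h => Finsupp.linearCombination ℤ h.1 (n g)
      map_zero' := by simp
      map_add' := fun a b => by
        simp [Finsupp.linearCombination_apply, smul_add, Finsupp.sum_add] }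
  have hψN (g : B) : N ≤ (ψ g).ker := fun h hh => by
    obtain ⟨m, hm⟩ := (mem_generatedSubgroup_iff z _).1 h.2
    change Finsupp.linearCombination ℤ h.1 (n g) = 0
    rw [← hm, ← hswap, hn]
    exact g.2 m h hh hm.symm
  let χ (g : B) := QuotientAddGroup.lift N (ψ g) (hψN g)
  have hχ (g : B) : Continuous (χ g) := by
    refine continuous_quot_lift _ ?_
    exact (Finsupp.continuous_linearCombination (n g)).comp continuous_subtype_val
  -- The value of `χ g` at the class of the column `z i` is the coordinate `g i`.
  have hχinj : Function.Injective χ := fun g g' h => by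
    refine Subtype.ext (Subtype.ext (funext fun i => ?_))
    have := DFunLike.congr_fun h
      ((⟨z i, mem_generatedSubgroup z i⟩ : generatedSubgroup z) : generatedSubgroup z ⧸ N)
    rw [← hn, ← hn, Finsupp.linearCombination_pi_apply, Finsupp.linearCombination_pi_apply]
    simp only [← hxz]
    exact this
  intro hlt
  have hle := mk_le_topWeight_of_characters
    ((isPrecompactAddGroup_of_compactSpace (generatedSubgroup z)).quotient N) χ hχ hχinj
  rw [hG B hBc hB0] at hle
  exact hle.not_gt (mul_lt_of_lt (aleph0_le_continuum.trans (cantor _).le) hlt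
    (aleph0_lt_continuum.trans (cantor _)))

end AlmostDisjoint

/-! ### The main theorem -/

theorem mainTheorem3 (hc : (2 : Cardinal.{u}) ^< 𝔠 = 𝔠) :
    (∀ ι κ : Type u, #ι = 𝔠 → #κ = 2 ^ (𝔠 : Cardinal.{u}) →
      ∃ (Y : κ → Set ι) (t : ι → UnitAddCircle) (e : ∀ k, ι ≃ Y k)
        (G : AddSubgroup (ι → UnitAddCircle)) (H : AddSubgroup (κ → UnitAddCircle)),
        -- an almost disjoint family of size `2 ^ 𝔠`
        Function.Injective Y ∧ IsAlmostDisjointFamily (Set.range Y) ∧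
        -- the two groups built from it
        LinearIndependent ℤ t ∧
        G = generatedSubgroup (fun (k : κ) (i : ι) => t (e k i)) ∧
        H = generatedSubgroup (fun (i : ι) (k : κ) => t (e k i)) ∧
        -- the subgroup of `T ^ 𝔠`
        Module.Free ℤ G ∧ Dense (G : Set (ι → UnitAddCircle)) ∧
        #G = 2 ^ (𝔠 : Cardinal.{u}) ∧
        (∀ B : AddSubgroup G, IsClosed (B : Set G) → B ≠ ⊥ → #B = 2 ^ (𝔠 : Cardinal.{u})) ∧
        -- the subgroup of `T ^ (2 ^ 𝔠)`
        Module.Free ℤ H ∧ Dense (H : Set (κ → UnitAddCircle)) ∧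
        IsZeroDimensional H ∧ #H = 𝔠 ∧
        (∀ N : AddSubgroup H, IsClosed (N : Set H) → N ≠ ⊤ →
          ¬ topWeight (H ⧸ N) < 2 ^ (𝔠 : Cardinal.{u}))) ∧
    IsLeast quotientWeightBounds.{u} (2 ^ (𝔠 : Cardinal.{u})) ∧
    leastQuotientWeight.{u} = 2 ^ (𝔠 : Cardinal.{u}) := by
  -- The statement on the least cardinal is derived from part (1), whose group `H` refutes every
  -- smaller bound.
  refine (and_iff_left_of_imp fun h => ?_).2 ?_
  · suffices hL : IsLeast quotientWeightBounds.{u} (2 ^ (𝔠 : Cardinal.{u})) from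
      ⟨hL, hL.csInf_eq⟩
    refine ⟨?_, ?_⟩
    · intro G _ _ _ _ _ hG
      obtain ⟨N, hN, hinf, hcard⟩ := exists_infinite_quotient_mk_le_continuum G hG
      exact ⟨N, hN, hinf, (topWeight_le_two_power _).trans (power_le_power_left two_ne_zero hcard)⟩
    · intro w hw
      by_contra! hlt
      obtain ⟨Y, t, e, G, H, -, -, -, -, -, -, -, -, -, -, -, -, hH, hq⟩ :=
        h (Quotient.out (𝔠 : Cardinal.{u}))
          (Quotient.out ((2 : Cardinal.{u}) ^ (𝔠 : Cardinal.{u})))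
          (mk_out _) (mk_out _)
      have : Infinite H := infinite_iff.2 (aleph0_le_continuum.trans_eq hH.symm)
      obtain ⟨N, hN, hinf, hle⟩ := hw H this (isPrecompactAddGroup_of_compactSpace H)
      refine hq N hN ?_ (hle.trans_lt hlt)
      rintro rfl
      exact not_finite (H ⧸ (⊤ : AddSubgroup H))
  · intro ι κ hι hκ
    have hκinf : Infinite κ :=
      infinite_iff.2 (hκ ▸ aleph0_le_continuum.trans (cantor _).le)
    have hιinf : Infinite ι := infinite_iff.2 (hι ▸ aleph0_le_continuum)
    obtain ⟨Y, hYc, hY⟩ := exists_almostDisjoint hc ι κ hι hκ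
    obtain ⟨t, ht⟩ := exists_linearIndependent_unitAddCircle ι hι
    have he (k : κ) : Nonempty (ι ≃ Y k) := Cardinal.eq.1 (hι.trans (hYc k).symm)
    let e (k : κ) : ι ≃ Y k := (he k).some
    have hx := linearIndependent_rows e hι ht hY
    have hz := linearIndependent_columns e ht
    have hGcard := (mk_generatedSubgroup hx).trans hκ
    have hGB := mk_closed_subgroup_rows e hc ht hY hGcard
    refine ⟨Y, t, e, _, _, fun k l hkl => ?_, ⟨?_, ?_⟩, ht, rfl, rfl, free_generatedSubgroup hx,
      dense_rows e ht, hGcard, hGB, free_generatedSubgroup hz, dense_columns e hx,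
      isZeroDimensional_columns e ht, (mk_generatedSubgroup hz).trans hι,
      topWeight_quotient_columns (fun _ _ => rfl) hx hGB⟩
    · by_contra hne
      have := hY k l hne
      rw [← hkl, Set.inter_self, hYc] at this
      exact this.false
    · rintro _ ⟨k, rfl⟩
      rw [hYc, hι]
    · rintro _ ⟨k, rfl⟩ _ ⟨l, rfl⟩ hkl
      rw [hι]
      exact hY k l fun h => hkl (h ▸ rfl)
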